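/- Let $A$, $B$, $J$ be finite-dimensional Hilbert spaces, let $\mathcal N:\mathcal L(A\otimes J)\to\mathcal L(B)$ be a completely positive trace-preserving (cptp) map (a quantum arbitrarily varying channel, with jammer system $J$), and let $\ell$ be a block length. A classical code with $M$ messages is a family $\mathcal C=\{(\rho_m,D_m)\}_{m=1}^M$ of states $\rho_m$ on $A^{\otimes\ell}$ and a POVM $(D_m)_m$ on $B^{\otimes\ell}$ (that is, $D_m\ge 0$ and $\sum_m D_m=\mathbf 1$); its error probability against a jammer state $\sigma$ on $J^{\otimes\ell}$ is $$P_{\mathrm{err}}(\mathcal C,\sigma)=\frac1M\sum_{m=1}^M\operatorname{tr}\,\mathcal N^{\otimes\ell}(\rho_m\otimes\sigma)(\mathbf 1-D_m).$$ A quantum code of dimension $L$ is a pair $\mathcal Q=(\mathcal E,\mathcal D)$ of cptp maps $\mathcal E:\mathcal L(\mathbb C^L)\to\mathcal L(A^{\otimes\ell})$, $\mathcal D:\mathcal L(B^{\otimes\ell})\to\mathcal L(\mathbb C^L)$; its infidelity against $\sigma$ is $$\widehat F(\mathcal Q,\sigma)=1-\operatorname{tr}\bigl((\mathrm{id}\otimes\mathcal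 D\circ\mathcal N^{\otimes\ell}_\sigma\circ\mathcal E)\Phi_L\bigr)\Phi_L,\qquad \Phi_L=\frac1L\sum_{i,j}|ii\rangle\langle jj|,\quad \mathcal N^{\otimes\ell}_\sigma(\rho)=\mathcal N^{\otimes\ell}(\rho\otimes\sigma).$$ A random classical [quantum] code is a family $(\mathcal C_\lambda)_{\lambda\in\Lambda}$ [$(\mathcal Q_\lambda)_{\lambda\in\Lambda}$] of such codes, with common $M$ [$L$], together with a probability distribution of $\lambda$ on $\Lambda$ for which $\lambda\mapsto P_{\mathrm{err}}(\mathcal C_\lambda,\sigma)$ [$\lambda\mapsto\widehat F(\mathcal Q_\lambda,\sigma)$] is measurable for every $\sigma$. It has error probability [infidelity] $\epsilon$ if $\sup_\sigma\mathbb E_\lambda P_{\mathrm{err}}(\mathcal C_\lambda,\sigma)\le\epsilon$ [$\sup_\sigma\mathbb E_\lambda\widehat F(\mathcal Q_\lambda,\sigma)\le\epsilon$], the supremum being over all states $\sigma$ on $J^{\otimes\ell}$. **Proposition.** Let $\delta>0$. 1. If $(\mathcal C_\lambda)_{\lambda\in\Lambda}$ is a random classical code of block length $\ell$ for $\mathcal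 N$ with error probability $\epsilon$, then there are $n\ge1$ with $n\le 1+\frac{1}{2\delta^2}(\ln|J|)\,\ell$ and $\lambda_1,\dots,\lambda_n\in\Lambda$ such that the random code $(\mathcal C_{\lambda_\nu})$ with $\nu$ uniformly distributed on $\{1,\dots,n\}$ has error probability $\le\epsilon+\delta$. 2. If $(\mathcal Q_\lambda)_{\lambda\in\Lambda}$ is a random quantum code of block length $\ell$ for $\mathcal N$ with infidelity $\epsilon$, then there are $n\ge1$ with $n\le 1+\frac{1}{2\delta^2}(\ln|J|)\,\ell$ and $\lambda_1,\dots,\lambda_n\in\Lambda$ such that the random code $(\mathcal Q_{\lambda_\nu})$ with $\nu$ uniformly distributed on $\{1,\dots,n\}$ has infidelity $\le\epsilon+\delta$. In both cases the number $\log_2 n$ of shared random bits is at most $b(\ell)$ for a function $b$ that depends only on $J$ and $\delta$ and satisfies $b(\ell)=O(\log\ell)$ as $\ell\to\infty$. -/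

import Mathlib

open scoped Kronecker ComplexOrder

noncomputable section

namespace QAVC

/-- The states (density matrices) of the finite-dimensional Hilbert space with orthonormal
basis `P`. -/
structure State (P : Type*) [Fintype P] where
  mat : Matrix P P ℂ
  posSemidef : mat.PosSemidef
  trace_eq_one : mat.trace = 1

/-- `id_R ⊗ T`, acting blockwise. -/
def idTensor (R : Type*) {P Q : Type*} (T : Matrix P P ℂ →ₗ[ℂ] Matrix Q Q ℂ) :
    Matrix (R × P) (R × P) ℂ →ₗ[ℂ] Matrix (R × Q) (R × Q) ℂ where
  toFun X := Matrix.of fun x y => T (X.submatrix (Prod.mk x.1) (Prod.mk y.1)) x.2 y.2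
  map_add' X Y := by
    ext x y
    simp [Matrix.submatrix_add]
  map_smul' c X := by
    ext x y
    simp [Matrix.submatrix_smul]

/-- Completely positive trace-preserving maps `L(P) → L(Q)`. -/
structure Channel (P Q : Type*) [Fintype P] [Fintype Q] where
  map : Matrix P P ℂ →ₗ[ℂ] Matrix Q Q ℂ
  completelyPositive : ∀ (k : ℕ) (X : Matrix (Fin k × P) (Fin k × P) ℂ),
    X.PosSemidef → (idTensor (Fin k) map X).PosSemidef
  tracePreserving : ∀ X : Matrix P P ℂ, (map X).trace = X.trace

section

variable {A B J : Type*} [Fintype A] [DecidableEq A] [Fintype B] [DecidableEq B]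
  [Fintype J] [DecidableEq J]

/-- The tensor power `N^{⊗ℓ} : L(A^ℓ ⊗ J^ℓ) → L(B^ℓ)`, where `A^ℓ` has the product basis
`Fin ℓ → A`, and similarly for `J` and `B`. It is the linear map that sends the matrix unit
`|a,j⟩⟨a',j'|` to the tensor product over `i` of the matrices `N(|a_i,j_i⟩⟨a'_i,j'_i|)`. -/
def tensorPower (N : Matrix (A × J) (A × J) ℂ →ₗ[ℂ] Matrix B B ℂ) (ℓ : ℕ) :
    Matrix ((Fin ℓ → A) × (Fin ℓ → J)) ((Fin ℓ → A) × (Fin ℓ → J)) ℂ →ₗ[ℂ]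
      Matrix (Fin ℓ → B) (Fin ℓ → B) ℂ where
  toFun X := Matrix.of fun b b' => ∑ x, ∑ y, X x y *
    ∏ i, N (Matrix.single (x.1 i, x.2 i) (y.1 i, y.2 i) 1) (b i) (b' i)
  map_add' X Y := by
    ext b b'
    simp [add_mul, Finset.sum_add_distrib]
  map_smul' c X := by
    ext b b'
    simp [Finset.mul_sum, mul_assoc]

/-- The map `ρ ↦ T(ρ ⊗ σ)` obtained by fixing the second input of `T` to `σ`. -/
def fixSecond {P R Q : Type*} (T : Matrix (P × R) (P × R) ℂ →ₗ[ℂ] Matrix Q Q ℂ)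
    (σ : Matrix R R ℂ) : Matrix P P ℂ →ₗ[ℂ] Matrix Q Q ℂ where
  toFun ρ := T (ρ ⊗ₖ σ)
  map_add' X Y := by rw [Matrix.add_kronecker, map_add]
  map_smul' c X := by rw [Matrix.smul_kronecker, map_smul, RingHom.id_apply]

/-- Deterministic classical codes with `M` messages for block length `ℓ`: input states `ρ_m`
on `A^ℓ` and a POVM `(D_m)` on `B^ℓ`. -/
structure ClassicalCode (A B : Type*) [Fintype A] [Fintype B] [DecidableEq B] (ℓ M : ℕ) where
  encoder : Fin M → State (Fin ℓ → A)
  decoder : Fin M → Matrix (Fin ℓ → B) (Fin ℓ → B) ℂ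
  decoder_posSemidef : ∀ m, (decoder m).PosSemidef
  decoder_sum : ∑ m, decoder m = 1

/-- The average error probability `P_err(C, σ)` against the jammer state `σ` on `J^ℓ`. -/
def errorProb (N : Channel (A × J) B) {ℓ M : ℕ} (C : ClassicalCode A B ℓ M)
    (σ : State (Fin ℓ → J)) : ℝ :=
  (1 / M : ℝ) * ∑ m, (Matrix.trace
    (tensorPower N.map ℓ ((C.encoder m).mat ⊗ₖ σ.mat) * (1 - C.decoder m))).re

/-- Deterministic quantum codes of dimension `L` for block length `ℓ`. -/
structure QuantumCode (A B : Type*) [Fintype A] [Fintype B] (ℓ L : ℕ) where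
  encoder : Channel (Fin L) (Fin ℓ → A)
  decoder : Channel (Fin ℓ → B) (Fin L)

/-- The maximally entangled state `Φ_L = (1/L) ∑_{i,j} |ii⟩⟨jj|`. -/
def maxEntangled (L : ℕ) : Matrix (Fin L × Fin L) (Fin L × Fin L) ℂ :=
  (1 / L : ℂ) • ∑ i : Fin L, ∑ j : Fin L, Matrix.single (i, i) (j, j) 1

/-- The infidelity `F̂(Q, σ) = 1 - tr (((id ⊗ D ∘ (N^{⊗ℓ})_σ ∘ E) Φ_L) · Φ_L)` against the
jammer state `σ` on `J^ℓ`. -/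
def infidelity (N : Channel (A × J) B) {ℓ L : ℕ} (Q : QuantumCode A B ℓ L)
    (σ : State (Fin ℓ → J)) : ℝ :=
  1 - (Matrix.trace (idTensor (Fin L)
    (Q.decoder.map ∘ₗ fixSecond (tensorPower N.map ℓ) σ.mat ∘ₗ Q.encoder.map)
    (maxEntangled L) * maxEntangled L)).re

end

/-- A random code with values in a set of deterministic codes whose error against a jammer state
`σ : S` is measured by `err`: a probability distribution on `Λ` and a family of deterministic
codes indexed by `Λ`, such that the error against each jammer state is a random variable. -/
structure RandomCode {Code S : Type*} (err : Code → S → ℝ) (Λ : Type*) [MeasurableSpace Λ] where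
  law : MeasureTheory.Measure Λ
  isProbabilityMeasure : MeasureTheory.IsProbabilityMeasure law
  code : Λ → Code
  aemeasurable_err : ∀ σ, AEMeasurable (fun x => err (code x) σ) law

/-- `sup_σ E_λ err(C_λ, σ) ≤ ε`. -/
def RandomCode.HasError {Code S : Type*} {err : Code → S → ℝ} {Λ : Type*} [MeasurableSpace Λ]
    (C : RandomCode err Λ) (ε : ℝ) : Prop :=
  ∀ σ, ∫ x, err (C.code x) σ ∂C.law ≤ ε

/-- The random code `(C_{λ_ν})` with `ν` uniformly distributed on `n` elements. -/
def RandomCode.select {Code S : Type*} {err : Code → S → ℝ} {Λ : Type*} [MeasurableSpace Λ]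
    (C : RandomCode err Λ) {n : ℕ} [NeZero n] (lam : Fin n → Λ) : RandomCode err (Fin n) where
  law := (PMF.uniformOfFintype (Fin n)).toMeasure
  isProbabilityMeasure := inferInstance
  code := fun ν => C.code (lam ν)
  aemeasurable_err := fun _ => Measurable.of_discrete.aemeasurable

/-- Random classical codes of block length `ℓ` with `M` messages for `N`. -/
abbrev RandomClassicalCode {A B J : Type*} [Fintype A] [DecidableEq A] [Fintype B]
    [DecidableEq B] [Fintype J] [DecidableEq J] (N : Channel (A × J) B) (ℓ M : ℕ)
    (Λ : Type*) [MeasurableSpace Λ] :=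
  RandomCode (errorProb N (ℓ := ℓ) (M := M)) Λ

/-- Random quantum codes of block length `ℓ` and dimension `L` for `N`. -/
abbrev RandomQuantumCode {A B J : Type*} [Fintype A] [DecidableEq A] [Fintype B]
    [DecidableEq B] [Fintype J] [DecidableEq J] (N : Channel (A × J) B) (ℓ L : ℕ)
    (Λ : Type*) [MeasurableSpace Λ] :=
  RandomCode (infidelity N (ℓ := ℓ) (L := L)) Λ

end QAVC

end

/-! Both error functions are linear in the jammer state: `err C_λ σ = tr σ X_λ` with `0 ≤ X_λ ≤ 1`
(`exists_effect`). It therefore suffices to find `n` codes whose average effect has expectation at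
most `ε + δ` in every state.

The codes are chosen greedily, by matrix multiplicative weights, with potential `tr exp S` for `S =
t ∑ X`. Since the random code has mean error at most `ε` against the Gibbs state of `S`, some code
has error `μ ≤ ε` there. Adding its effect multiplies the potential by at most `1 + (e^t - 1) μ ≤
exp (t ε + t² / 8)`, by `trace_exp_add_smul_le` and Hoeffding's lemma. The potential starts at `d`,
the dimension of the jammer's space, and its logarithm bounds `tr σ S` for every `σ`. Hence the
average error is at most `(log d) / (n t) + ε + t / 8`, which is at most `ε + δ` for `t = 4 δ` and
`n ≥ (log d) / (2 δ²)`. No net of jammer states and no union bound is needed.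

The bound on the potential comes from a discrete Grönwall argument along `S + s X`, fed by scalar
inequalities at pairs of eigenvalues. -/

namespace QAVC

/-! ### Trace inequalities for two Hermitian matrices -/

section TraceInequalities

variable {P : Type*} [Fintype P] [DecidableEq P]

/-- The trace of a product of functions of two Hermitian matrices is a nonnegative mixture of the
products of the functions at pairs of eigenvalues. -/
theorem exists_trace_cfc_mul_cfc {H K : Matrix P P ℂ} (hH : H.IsHermitian) (hK : K.IsHermitian) :
    ∃ c : P → P → ℝ, (∀ i j, 0 ≤ c i j) ∧ ∀ f g : ℝ → ℝ,
      (cfc f H * cfc g K).trace.re =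
        ∑ i, ∑ j, c i j * (f (hH.eigenvalues i) * g (hK.eigenvalues j)) := by
  let U : Matrix P P ℂ := ↑hH.eigenvectorUnitary
  let V : Matrix P P ℂ := ↑hK.eigenvectorUnitary
  -- The weights are the squared overlaps of the two eigenbases.
  refine ⟨fun i j => Complex.normSq ((star U * V) i j), fun i j => Complex.normSq_nonneg _,
    fun f g => ?_⟩
  have key : (cfc f H * cfc g K).trace =
      (Matrix.diagonal (fun i => (f (hH.eigenvalues i) : ℂ)) * (star U * V) *
        Matrix.diagonal (fun i => (g (hK.eigenvalues i) : ℂ)) * star (star U * V)).trace := by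
    rw [hH.cfc_eq, hK.cfc_eq, Matrix.IsHermitian.cfc, Matrix.IsHermitian.cfc,
      Unitary.conjStarAlgAut_apply, Unitary.conjStarAlgAut_apply, star_mul, star_star]
    simp only [Matrix.mul_assoc]
    rw [Matrix.trace_mul_comm]
    simp only [Matrix.mul_assoc]
    rfl
  rw [key, Matrix.trace, Complex.re_sum]
  refine Finset.sum_congr rfl fun i _ => ?_
  rw [Matrix.diag_apply, Matrix.mul_apply, Complex.re_sum]
  refine Finset.sum_congr rfl fun j _ => ?_
  rw [Matrix.mul_diagonal, Matrix.diagonal_mul, Matrix.star_apply]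
  have : (f (hH.eigenvalues i) : ℂ) * (star U * V) i j * (g (hK.eigenvalues j) : ℂ) *
      star ((star U * V) i j) =
      (f (hH.eigenvalues i) : ℂ) * (g (hK.eigenvalues j) : ℂ) *
        ((star U * V) i j * (starRingEnd ℂ) ((star U * V) i j)) := by
    rw [Complex.star_def]; ring
  rw [this, Complex.mul_conj]
  norm_cast
  ring

theorem continuousOn_spectrum (f : ℝ → ℝ) (H : Matrix P P ℂ) :
    ContinuousOn f (spectrum ℝ H) :=
  (Matrix.finite_real_spectrum (A := H)).continuousOn f

theorem cfc_id_mul {H : Matrix P P ℂ} (hH : H.IsHermitian) (f : ℝ → ℝ) :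
    H * cfc f H = cfc (fun x => x * f x) H := by
  rw [cfc_mul (fun x => x) f H (continuousOn_spectrum _ _) (continuousOn_spectrum _ _),
    cfc_id' ℝ H hH.isSelfAdjoint]

theorem cfc_mul_id {H : Matrix P P ℂ} (hH : H.IsHermitian) (f : ℝ → ℝ) :
    cfc f H * H = cfc (fun x => x * f x) H := by
  simp only [mul_comm _ (f _)]
  rw [cfc_mul f (fun x => x) H (continuousOn_spectrum _ _) (continuousOn_spectrum _ _),
    cfc_id' ℝ H hH.isSelfAdjoint]

/-- The logarithmic mean of two exponentials is at most their arithmetic mean. -/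
theorem sub_mul_exp_sub_exp_le (x y : ℝ) :
    (y - x) * (Real.exp y - Real.exp x) ≤ (y - x) ^ 2 * (Real.exp y + Real.exp x) / 2 := by
  wlog h : x ≤ y generalizing x y
  · have := this y x (le_of_not_ge h)
    nlinarith
  -- With `u = y - x`, after division by `u e^x / 2`, the claim is `2 (e^u - 1) ≤ u (e^u + 1)`.
  have key : ∀ u : ℝ, 0 ≤ u → 0 ≤ (u - 2) * Real.exp u + u + 2 := by
    have hd : ∀ u : ℝ, HasDerivAt (fun u : ℝ => (u - 2) * Real.exp u + u + 2)
        ((u - 1) * Real.exp u + 1) u := by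
      intro u
      refine (((((hasDerivAt_id' u).sub_const 2).mul (Real.hasDerivAt_exp u)).add
        (hasDerivAt_id' u)).add_const 2).congr_deriv ?_
      ring
    have hm : Monotone (fun u : ℝ => (u - 2) * Real.exp u + u + 2) := by
      apply monotone_of_deriv_nonneg (fun u => (hd u).differentiableAt)
      intro u
      rw [(hd u).deriv]
      have h1 := Real.add_one_le_exp (-u)
      have h2 : Real.exp (-u) * Real.exp u = 1 := by rw [← Real.exp_add]; simp
      nlinarith [Real.exp_pos u]
    intro u hu
    have := hm hu
    simpa using this
  have h1 := key (y - x) (by linarith)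
  have h2 : Real.exp y = Real.exp (y - x) * Real.exp x := by rw [← Real.exp_add]; simp
  have h3 : 0 ≤ (y - x) * Real.exp x * (((y - x) - 2) * Real.exp (y - x) + (y - x) + 2) :=
    mul_nonneg (mul_nonneg (by linarith) (Real.exp_pos _).le) h1
  rw [h2]
  linarith

/-- Klein's inequality for the exponential function. -/
theorem trace_exp_sub_trace_exp_le {H K : Matrix P P ℂ} (hH : H.IsHermitian)
    (hK : K.IsHermitian) :
    (cfc Real.exp K).trace.re - (cfc Real.exp H).trace.re ≤
      ((K - H) * cfc Real.exp K).trace.re := by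
  obtain ⟨c, hc, h⟩ := exists_trace_cfc_mul_cfc hH hK
  -- With common weights, only the convexity bound `e^y - e^x ≤ (y - x) e^y` remains.
  have h1 := h (fun _ => 1) Real.exp
  have h2 := h Real.exp (fun _ => 1)
  have h3 := h (fun _ => 1) (fun x => x * Real.exp x)
  have h4 := h (fun x => x) Real.exp
  rw [cfc_const_one ℝ H, one_mul] at h1 h3
  rw [cfc_const_one ℝ K, mul_one] at h2
  rw [cfc_id' ℝ H hH.isSelfAdjoint] at h4
  rw [← cfc_id_mul hK] at h3
  rw [sub_mul, Matrix.trace_sub, Complex.sub_re, h1, h2, h3, h4]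
  simp only [← Finset.sum_sub_distrib, ← mul_sub]
  refine Finset.sum_le_sum fun i _ => Finset.sum_le_sum fun j _ =>
    mul_le_mul_of_nonneg_left ?_ (hc i j)
  set x := hH.eigenvalues i
  set y := hK.eigenvalues j
  have h5 := Real.add_one_le_exp (x - y)
  have h6 : Real.exp x = Real.exp (x - y) * Real.exp y := by rw [← Real.exp_add]; simp
  nlinarith [Real.exp_pos y]

/-- In the two eigenbases this is the comparison of logarithmic and arithmetic means, summed with
the weights `c i j`. It serves as a finite-difference form of `d/ds tr X exp (S + s X) ≤ tr X² exp
(S + s X)`. -/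
theorem trace_sub_mul_exp_sub_exp_le {H K : Matrix P P ℂ} (hH : H.IsHermitian)
    (hK : K.IsHermitian) :
    ((K - H) * cfc Real.exp K).trace.re - ((K - H) * cfc Real.exp H).trace.re ≤
      (((K - H) * (K - H) * cfc Real.exp K).trace.re +
        ((K - H) * (K - H) * cfc Real.exp H).trace.re) / 2 := by
  obtain ⟨c, hc, h⟩ := exists_trace_cfc_mul_cfc hH hK
  have fH := cfc_id' ℝ H hH.isSelfAdjoint
  have fK := cfc_id' ℝ K hK.isSelfAdjoint
  have o1 := cfc_const_one ℝ H
  have o2 := cfc_const_one ℝ K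
  have hHH := cfc_id_mul hH (fun x => x)
  have hKK := cfc_id_mul hK (fun x => x)
  rw [fH] at hHH
  rw [fK] at hKK
  -- Cyclicity brings each expanded term to the form `tr f(H) g(K)`: the `a` terms give the left
  -- side, `b` and `d` the squares against `exp K` and `exp H`.
  have a1 := h (fun _ => 1) (fun x => x * Real.exp x)
  rw [o1, one_mul, ← cfc_id_mul hK] at a1
  have a2 := h (fun x => x) Real.exp
  rw [fH] at a2
  have a3 := h Real.exp (fun x => x)
  rw [fK, Matrix.trace_mul_comm] at a3
  have a4 := h (fun x => x * Real.exp x) (fun _ => 1)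
  rw [o2, mul_one, ← cfc_id_mul hH] at a4
  have b1 := h (fun _ => 1) (fun x => x * (x * Real.exp x))
  rw [o1, one_mul, ← cfc_id_mul hK, ← cfc_id_mul hK] at b1
  have b2 := h (fun x => x) (fun x => x * Real.exp x)
  rw [fH] at b2
  have b3 := b2
  rw [← cfc_id_mul hK] at b2
  rw [← cfc_mul_id hK, ← Matrix.mul_assoc, Matrix.trace_mul_comm] at b3
  have b4 := h (fun x => x * x) Real.exp
  rw [← hHH, Matrix.mul_assoc] at b4
  have d1 := h Real.exp (fun x => x * x)
  rw [← hKK, Matrix.trace_mul_comm, Matrix.mul_assoc] at d1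
  have d2 := h (fun x => x * Real.exp x) (fun x => x)
  rw [fK, Matrix.trace_mul_comm] at d2
  have d3 := d2
  rw [← cfc_id_mul hH] at d2
  rw [← cfc_mul_id hH, ← Matrix.mul_assoc, Matrix.trace_mul_comm] at d3
  have d4 := h (fun x => x * (x * Real.exp x)) (fun _ => 1)
  rw [o2, mul_one, ← cfc_id_mul hH, ← cfc_id_mul hH] at d4
  simp only [sub_mul, mul_sub, Matrix.mul_assoc, Matrix.trace_sub, Complex.sub_re]
  rw [a1, a2, a3, a4, b1, b2, b3, b4, d1, d2, d3, d4]
  rw [le_div_iff₀ two_pos]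
  simp only [← Finset.sum_sub_distrib, ← Finset.sum_add_distrib, Finset.sum_mul]
  refine Finset.sum_le_sum fun i _ => Finset.sum_le_sum fun j _ => ?_
  have := mul_le_mul_of_nonneg_left
    (sub_mul_exp_sub_exp_le (hH.eigenvalues i) (hK.eigenvalues j)) (hc i j)
  linarith

open scoped MatrixOrder in
theorem _root_.Matrix.PosSemidef.exists_eq_conjTranspose_mul_self {X : Matrix P P ℂ}
    (hX : X.PosSemidef) : ∃ B : Matrix P P ℂ, X = B.conjTranspose * B :=
  CStarAlgebra.nonneg_iff_eq_star_mul_self.1 hX.nonneg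

theorem _root_.Matrix.PosSemidef.trace_mul_re_nonneg {X Y : Matrix P P ℂ} (hX : X.PosSemidef)
    (hY : Y.PosSemidef) : 0 ≤ (X * Y).trace.re := by
  obtain ⟨B, rfl⟩ := hY.exists_eq_conjTranspose_mul_self
  rw [← Matrix.mul_assoc, Matrix.trace_mul_comm, ← Matrix.mul_assoc]
  exact (Complex.le_def.1 (hX.mul_mul_conjTranspose_same B).trace_nonneg).1

end TraceInequalities

/-! ### Growth of the exponential potential and greedy selection -/

section MultiplicativeWeights

theorem isHermitian_add_smul {P : Type*} {S X : Matrix P P ℂ} (hS : S.IsHermitian) (hX : X.IsHermitian)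
    (t : ℝ) : (S + t • X).IsHermitian := by
  refine hS.add ?_
  rw [Matrix.IsHermitian, Matrix.conjTranspose_smul, hX.eq, star_trivial]

variable {P : Type*} [Fintype P] [DecidableEq P]

open scoped MatrixOrder in
theorem posSemidef_cfc_exp (H : Matrix P P ℂ) : (cfc Real.exp H).PosSemidef :=
  Matrix.nonneg_iff_posSemidef.1 (cfc_nonneg fun x _ => (Real.exp_pos x).le)

/-- `X - X² = X (1 - X) X + (1 - X) X (1 - X)`. -/
theorem posSemidef_sub_mul_self {X : Matrix P P ℂ} (h0 : X.PosSemidef)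
    (h1 : (1 - X).PosSemidef) : (X - X * X).PosSemidef := by
  have a := h1.mul_mul_conjTranspose_same X
  have b := h0.mul_mul_conjTranspose_same (1 - X)
  rw [h0.1.eq] at a
  rw [h1.1.eq] at b
  convert a.add b using 1
  noncomm_ring

/-- `tr exp (S + t X) ≤ tr exp S (1 + (exp t - 1) X)` for Hermitian `S` and `0 ≤ X ≤ 1`. -/
theorem trace_exp_add_smul_le {S X : Matrix P P ℂ} (hS : S.IsHermitian) (h0 : X.PosSemidef)
    (h1 : (1 - X).PosSemidef) {t : ℝ} (ht : 0 ≤ t) :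
    (cfc Real.exp (S + t • X)).trace.re ≤
      (cfc Real.exp S).trace.re + (Real.exp t - 1) * (X * cfc Real.exp S).trace.re := by
  -- Formally `g' = p` and `p' ≤ p`, so `p s ≤ e^s p 0` and integration gives the claim. Finite
  -- differences avoid differentiating the matrix exponential.
  set g : ℝ → ℝ := fun s => (cfc Real.exp (S + s • X)).trace.re with hg
  set p : ℝ → ℝ := fun s => (X * cfc Real.exp (S + s • X)).trace.re with hp
  have hp0 : ∀ s, 0 ≤ p s := fun s => h0.trace_mul_re_nonneg (posSemidef_cfc_exp _)
  have hw : ∀ s, (X * X * cfc Real.exp (S + s • X)).trace.re ≤ p s := fun s => by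
    have := (posSemidef_sub_mul_self h0 h1).trace_mul_re_nonneg
      (posSemidef_cfc_exp (S + s • X))
    rw [sub_mul, Matrix.trace_sub, Complex.sub_re] at this
    linarith
  have hsub : ∀ s h : ℝ, (S + (s + h) • X) - (S + s • X) = h • X := fun s h => by
    rw [add_smul]; abel
  have hgstep : ∀ s h : ℝ, g (s + h) - g s ≤ h * p (s + h) := fun s h => by
    have := trace_exp_sub_trace_exp_le (isHermitian_add_smul hS h0.1 s)
      (isHermitian_add_smul hS h0.1 (s + h))
    simpa [hsub] using this
  have hpstep : ∀ s h : ℝ, 0 < h → (1 - h / 2) * p (s + h) ≤ (1 + h / 2) * p s := by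
    intro s h hh
    have := trace_sub_mul_exp_sub_exp_le (isHermitian_add_smul hS h0.1 s)
      (isHermitian_add_smul hS h0.1 (s + h))
    rw [hsub] at this
    simp only [Matrix.smul_mul, Matrix.mul_smul, Matrix.trace_smul, Complex.smul_re,
      smul_eq_mul] at this
    have h3 : h * (p (s + h) - p s) ≤ h * (h * (p (s + h) + p s) / 2) := by
      have a := mul_le_mul_of_nonneg_left (hw s) (mul_self_nonneg h)
      have b := mul_le_mul_of_nonneg_left (hw (s + h)) (mul_self_nonneg h)
      simp only [hp] at a b ⊢
      linarith
    have := le_of_mul_le_mul_left h3 hh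
    linarith
  -- The growth ratio per step is `r = (1 + h/2) / (1 - h/2)`; the geometric sum `h (r + ⋯ + r^m)`
  -- equals `(1 + h/2) (r^m - 1)`.
  have hiter : ∀ h : ℝ, 0 < h → h < 2 → ∀ m : ℕ,
      p (m * h) ≤ (1 + h / (1 - h / 2)) ^ m * p 0 ∧
      g (m * h) ≤ g 0 + (1 + h / 2) * ((1 + h / (1 - h / 2)) ^ m - 1) * p 0 := by
    intro h hh hh2 m
    have hpos : 0 < 1 - h / 2 := by linarith
    induction m with
    | zero => simp
    | succ m ih =>
      obtain ⟨ih1, ih2⟩ := ih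
      have hr : (1 + h / 2) = (1 - h / 2) * (1 + h / (1 - h / 2)) := by
        rw [mul_add, mul_div_cancel₀ _ hpos.ne']; ring
      have hr0 : 0 ≤ 1 + h / (1 - h / 2) := by positivity
      set r := 1 + h / (1 - h / 2) with hrdef
      have e : ((m + 1 : ℕ) : ℝ) * h = m * h + h := by push_cast; ring
      have hp1 : p (m * h + h) ≤ r ^ (m + 1) * p 0 := by
        have a := hpstep (m * h) h hh
        rw [hr, mul_assoc] at a
        have b := le_of_mul_le_mul_left a hpos
        calc _ ≤ r * p (m * h) := b
          _ ≤ r * (r ^ m * p 0) := mul_le_mul_of_nonneg_left ih1 hr0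
          _ = _ := by ring
      rw [e]
      refine ⟨hp1, ?_⟩
      have a := hgstep (m * h) h
      have b := mul_le_mul_of_nonneg_left hp1 hh.le
      have c : (1 + h / 2) * (r ^ (m + 1) - 1) = (1 + h / 2) * (r ^ m - 1) + h * r ^ (m + 1) := by
        have : (1 + h / 2) * (r - 1) = h * r := by
          rw [hr]
          have : (1 - h / 2) * (r - 1) = h := by
            rw [hrdef, add_sub_cancel_left, mul_div_cancel₀ _ hpos.ne']
          linear_combination r * this
        rw [pow_succ]
        linear_combination r ^ m * this
      rw [c]
      linarith
  have hg0 : g 0 = (cfc Real.exp S).trace.re := by simp [hg]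
  have hp00 : p 0 = (X * cfc Real.exp S).trace.re := by simp [hp]
  rcases ht.eq_or_lt with rfl | ht
  · simp
  -- Here `h = t / m`, and `r^m` is replaced by its upper bound `exp (t / (1 - h/2))`.
  have hlim : Filter.Tendsto (fun m : ℕ => g 0 + (1 + (t / m) / 2) *
      (Real.exp (t / (1 - (t / m) / 2)) - 1) * p 0) Filter.atTop
      (nhds (g 0 + (1 + 0 / 2) * (Real.exp (t / (1 - 0 / 2)) - 1) * p 0)) := by
    have hz : Filter.Tendsto (fun m : ℕ => t / m) Filter.atTop (nhds 0) :=
      tendsto_const_div_atTop_nhds_zero_nat t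
    have hc : ContinuousAt (fun h : ℝ => g 0 + (1 + h / 2) *
      (Real.exp (t / (1 - h / 2)) - 1) * p 0) 0 := by
      have : (1 - (0 : ℝ) / 2) ≠ 0 := by norm_num
      fun_prop (disch := assumption)
    exact hc.tendsto.comp hz
  have hle : g t ≤ g 0 + (1 + 0 / 2) * (Real.exp (t / (1 - 0 / 2)) - 1) * p 0 := by
    refine ge_of_tendsto hlim ?_
    filter_upwards [Filter.eventually_gt_atTop ⌈t⌉₊] with m hm
    have hmt : t < m := (Nat.le_ceil t).trans_lt (by exact_mod_cast hm)
    have hm0 : (0 : ℝ) < m := ht.trans hmt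
    have hh : 0 < t / m := by positivity
    have hh1 : t / m < 1 := (div_lt_one hm0).2 hmt
    have hpos : 0 < 1 - t / m / 2 := by linarith
    have := (hiter (t / m) hh (by linarith) m).2
    rw [mul_div_cancel₀ t hm0.ne'] at this
    refine this.trans ?_
    have hr : (1 + t / m / (1 - t / m / 2)) ^ m ≤ Real.exp (t / (1 - t / m / 2)) := by
      calc _ ≤ (Real.exp (t / m / (1 - t / m / 2))) ^ m := by
            have := Real.add_one_le_exp (t / m / (1 - t / m / 2))
            exact pow_le_pow_left₀ (by positivity) (by linarith) m
        _ = _ := by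
            rw [← Real.exp_nat_mul]
            congr 1
            field_simp
    have := hp0 0
    gcongr
  rw [hg0, hp00] at hle
  simpa using hle

/-- Hoeffding's lemma for a Bernoulli variable. -/
theorem one_add_exp_sub_one_mul_le {μ : ℝ} (h0 : 0 ≤ μ) (h1 : μ ≤ 1) (t : ℝ) :
    1 + (Real.exp t - 1) * μ ≤ Real.exp (t * μ + t ^ 2 / 8) := by
  -- The Bernoulli law with mean `μ`; its range has length 1, so the variance proxy is `1/4`.
  let m : MeasureTheory.Measure ℝ := ENNReal.ofReal μ • MeasureTheory.Measure.dirac 1 +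
    ENNReal.ofReal (1 - μ) • MeasureTheory.Measure.dirac 0
  have hm : MeasureTheory.IsProbabilityMeasure m := ⟨by
    simp only [m, MeasureTheory.Measure.add_apply, MeasureTheory.Measure.smul_apply,
      MeasureTheory.measure_univ, smul_eq_mul, mul_one]
    rw [← ENNReal.ofReal_add h0 (by linarith)]
    simp⟩
  have hint : ∀ f : ℝ → ℝ, ∫ x, f x ∂m = μ * f 1 + (1 - μ) * f 0 := by
    intro f
    have hi : ∀ (a c : ℝ), MeasureTheory.Integrable f
        (ENNReal.ofReal c • MeasureTheory.Measure.dirac a) := fun a c =>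
      (MeasureTheory.integrable_dirac (by simp)).smul_measure ENNReal.ofReal_ne_top
    rw [MeasureTheory.integral_add_measure (hi _ _) (hi _ _)]
    simp [MeasureTheory.integral_smul_measure, ENNReal.toReal_ofReal h0,
      ENNReal.toReal_ofReal (sub_nonneg.2 h1)]
  have hH := ProbabilityTheory.hasSubgaussianMGF_of_mem_Icc (μ := m) (X := fun x : ℝ => x)
    (a := 0) (b := 1) measurable_id.aemeasurable (by
      simp only [m, MeasureTheory.ae_add_measure_iff]
      constructor <;> refine MeasureTheory.Measure.ae_smul_measure ?_ _ <;>
        simp [MeasureTheory.ae_dirac_eq])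
  have := hH.mgf_le t
  rw [ProbabilityTheory.mgf, hint, hint (fun x => x)] at this
  simp only [mul_one, mul_zero, add_zero, sub_zero, nnnorm_one, zero_sub] at this
  have h2 := mul_le_mul_of_nonneg_right this (Real.exp_pos (t * μ)).le
  rw [add_mul, mul_assoc, mul_assoc, ← Real.exp_add, ← Real.exp_add, ← Real.exp_add] at h2
  rw [show t * (1 - μ) + t * μ = t by ring, show t * -μ + t * μ = 0 by ring, Real.exp_zero] at h2
  have e : (((1 / 2) ^ 2 : NNReal) : ℝ) * t ^ 2 / 2 + t * μ = t * μ + t ^ 2 / 8 := by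
    push_cast
    ring
  rw [e] at h2
  linarith

theorem trace_cfc {H : Matrix P P ℂ} (hH : H.IsHermitian) (f : ℝ → ℝ) :
    (cfc f H).trace.re = ∑ i, f (hH.eigenvalues i) := by
  rw [hH.cfc_eq, Matrix.IsHermitian.cfc, Unitary.conjStarAlgAut_apply, Matrix.trace_mul_comm,
    ← Matrix.mul_assoc, Unitary.coe_star_mul_self, one_mul, Matrix.trace_diagonal,
    Complex.re_sum]
  simp

/-- A Hermitian matrix is bounded in every state by the logarithm of the trace of its
exponential. -/
theorem State.trace_mul_le_log_trace_exp (σ : State P) {H : Matrix P P ℂ} (hH : H.IsHermitian) :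
    (σ.mat * H).trace.re ≤ Real.log (cfc Real.exp H).trace.re := by
  obtain ⟨c, hc, h⟩ := exists_trace_cfc_mul_cfc σ.posSemidef.1 hH
  have h1 := h (fun x => x) (fun x => x)
  have h2 := h (fun x => x) (fun _ => 1)
  rw [cfc_id' ℝ _ σ.posSemidef.1.isSelfAdjoint] at h1 h2
  rw [cfc_id' ℝ _ hH.isSelfAdjoint] at h1
  rw [cfc_const_one ℝ H, mul_one, σ.trace_eq_one, Complex.one_re] at h2
  -- The factor 1 is `tr σ`, the total weight of the mixture, so it is enough to bound each
  -- eigenvalue of `H`.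
  rw [h1, ← one_mul (Real.log _), h2, Finset.sum_mul]
  refine Finset.sum_le_sum fun i _ => ?_
  rw [Finset.sum_mul]
  refine Finset.sum_le_sum fun j _ => ?_
  have hs := σ.posSemidef.eigenvalues_nonneg i
  have hj : hH.eigenvalues j ≤ Real.log (cfc Real.exp H).trace.re := by
    have hle : Real.exp (hH.eigenvalues j) ≤ (cfc Real.exp H).trace.re := by
      rw [trace_cfc hH]
      exact Finset.single_le_sum (f := fun i => Real.exp (hH.eigenvalues i))
        (fun i _ => (Real.exp_pos _).le) (Finset.mem_univ j)
    exact (Real.le_log_iff_exp_le ((Real.exp_pos _).trans_le hle)).2 hle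
  rw [mul_one, mul_assoc]
  exact mul_le_mul_of_nonneg_left (mul_le_mul_of_nonneg_left hj hs) (hc i j)

/-- The Gibbs state `exp H / tr exp H`. -/
noncomputable def gibbsState [Nonempty P] {H : Matrix P P ℂ} (hH : H.IsHermitian) : State P where
  mat := ((cfc Real.exp H).trace.re)⁻¹ • cfc Real.exp H
  posSemidef := (posSemidef_cfc_exp H).smul (inv_nonneg.2
    (Complex.le_def.1 (posSemidef_cfc_exp H).trace_nonneg).1)
  trace_eq_one := by
    have him : (cfc Real.exp H).trace = ((cfc Real.exp H).trace.re : ℂ) :=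
      Complex.ext rfl (Complex.le_def.1 (posSemidef_cfc_exp H).trace_nonneg).2.symm
    have hpos : 0 < (cfc Real.exp H).trace.re := by
      rw [trace_cfc hH]
      exact Finset.sum_pos (fun i _ => Real.exp_pos _) Finset.univ_nonempty
    rw [Matrix.trace_smul, him, Complex.ofReal_re, Complex.real_smul, ← Complex.ofReal_mul,
      inv_mul_cancel₀ hpos.ne', Complex.ofReal_one]

theorem State.trace_mul_re_mem_Icc (σ : State P) {X : Matrix P P ℂ} (h0 : X.PosSemidef)
    (h1 : (1 - X).PosSemidef) : (σ.mat * X).trace.re ∈ Set.Icc (0 : ℝ) 1 := by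
  refine ⟨σ.posSemidef.trace_mul_re_nonneg h0, ?_⟩
  have := σ.posSemidef.trace_mul_re_nonneg h1
  rw [mul_sub, mul_one, Matrix.trace_sub, σ.trace_eq_one, Complex.sub_re, Complex.one_re] at this
  linarith

/-- If a family of matrices `0 ≤ X ≤ 1` contains, for every state, a matrix with expectation at
most `ε`, then some `n` of them have in every state a sum with expectation at most
`(log d) / t + n ε + n t / 8`. -/
theorem exists_sum_trace_mul_le [Nonempty P] {Λ : Type*} (X : Λ → Matrix P P ℂ)
    (h0 : ∀ x, (X x).PosSemidef) (h1 : ∀ x, (1 - X x).PosSemidef) {ε : ℝ}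
    (hε : ∀ σ : State P, ∃ x, (σ.mat * X x).trace.re ≤ ε) {t : ℝ} (ht : 0 < t) (n : ℕ) :
    ∃ lam : Fin n → Λ, ∀ σ : State P,
      t * ∑ ν, (σ.mat * X (lam ν)).trace.re ≤
        Real.log (Fintype.card P) + n * (t * ε + t ^ 2 / 8) := by
  have key : ∃ lam : Fin n → Λ, (cfc Real.exp (t • ∑ ν, X (lam ν))).trace.re ≤
      Fintype.card P * Real.exp (n * (t * ε + t ^ 2 / 8)) := by
    induction n with
    | zero =>
      refine ⟨Fin.elim0, ?_⟩
      simp [cfc_apply_zero]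
    | succ n ih =>
      obtain ⟨lam, hlam⟩ := ih
      have hS : (t • ∑ ν, X (lam ν)).IsHermitian := by
        have : (∑ ν, X (lam ν)).PosSemidef := Matrix.posSemidef_sum _ fun ν _ => h0 _
        exact (this.smul ht.le).1
      set S := t • ∑ ν, X (lam ν) with hSdef
      -- The next element is chosen against the Gibbs state of those already chosen.
      obtain ⟨x, hx⟩ := hε (gibbsState hS)
      have hmem := (gibbsState hS).trace_mul_re_mem_Icc (h0 x) (h1 x)
      refine ⟨Fin.snoc lam x, ?_⟩
      have hsum : t • ∑ ν, X ((Fin.snoc lam x : Fin (n + 1) → Λ) ν) = S + t • X x := by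
        rw [Fin.sum_univ_castSucc]
        simp [hSdef, smul_add]
      have hpos : 0 < (cfc Real.exp S).trace.re := by
        rw [trace_cfc hS]
        exact Finset.sum_pos (fun i _ => Real.exp_pos _) Finset.univ_nonempty
      have hμ : (X x * cfc Real.exp S).trace.re =
          (cfc Real.exp S).trace.re * ((gibbsState hS).mat * X x).trace.re := by
        rw [gibbsState, Matrix.smul_mul, Matrix.trace_smul, Complex.smul_re, smul_eq_mul,
          mul_inv_cancel_left₀ hpos.ne', Matrix.trace_mul_comm]
      set μ := ((gibbsState hS).mat * X x).trace.re
      rw [hsum]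
      calc _ ≤ (cfc Real.exp S).trace.re +
            (Real.exp t - 1) * (X x * cfc Real.exp S).trace.re :=
            trace_exp_add_smul_le hS (h0 x) (h1 x) ht.le
        _ = (cfc Real.exp S).trace.re * (1 + (Real.exp t - 1) * μ) := by rw [hμ]; ring
        _ ≤ (cfc Real.exp S).trace.re * Real.exp (t * ε + t ^ 2 / 8) := by
            -- Hoeffding's lemma is used at `μ ∈ [0, 1]`, before passing to `ε`, which need not lie
            -- in `[0, 1]`.
            refine mul_le_mul_of_nonneg_left
              ((one_add_exp_sub_one_mul_le hmem.1 hmem.2 t).trans ?_) hpos.le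
            gcongr
        _ ≤ (Fintype.card P * Real.exp (n * (t * ε + t ^ 2 / 8))) *
              Real.exp (t * ε + t ^ 2 / 8) := by gcongr
        _ = _ := by
            rw [mul_assoc, ← Real.exp_add]
            congr 2
            push_cast
            ring
  obtain ⟨lam, hlam⟩ := key
  refine ⟨lam, fun σ => ?_⟩
  have hS : (t • ∑ ν, X (lam ν)).IsHermitian := by
    have : (∑ ν, X (lam ν)).PosSemidef := Matrix.posSemidef_sum _ fun ν _ => h0 _
    exact (this.smul ht.le).1
  have hpos : 0 < (cfc Real.exp (t • ∑ ν, X (lam ν))).trace.re := by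
    rw [trace_cfc hS]
    exact Finset.sum_pos (fun i _ => Real.exp_pos _) Finset.univ_nonempty
  have h := (σ.trace_mul_le_log_trace_exp hS).trans (Real.log_le_log hpos hlam)
  rw [Real.log_mul (by simp) (Real.exp_pos _).ne', Real.log_exp] at h
  refine le_trans (le_of_eq ?_) h
  rw [Matrix.mul_smul, Matrix.trace_smul, Complex.smul_re, smul_eq_mul, Matrix.mul_sum,
    Matrix.trace_sum, Complex.re_sum]

end MultiplicativeWeights

/-! ### Linear functionals on states as effects -/

section Effects

variable {P : Type*} [Fintype P] [DecidableEq P]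

/-- A linear functional on matrices whose real part maps states into `[0, 1]` is on states the
expectation of a matrix `0 ≤ X ≤ 1`. -/
theorem exists_effect (f : Matrix P P ℂ →ₗ[ℂ] ℂ)
    (hf : ∀ σ : State P, (f σ.mat).re ∈ Set.Icc (0 : ℝ) 1) :
    ∃ X : Matrix P P ℂ, X.PosSemidef ∧ (1 - X).PosSemidef ∧
      ∀ σ : State P, (f σ.mat).re = (σ.mat * X).trace.re := by
  let E : Matrix P P ℂ := Matrix.of fun i j => f (Matrix.single j i 1)
  have hE : ∀ Y : Matrix P P ℂ, f Y = (Y * E).trace := by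
    intro Y
    conv_lhs => rw [Matrix.matrix_eq_sum_single Y]
    simp only [map_sum, Matrix.trace, Matrix.diag_apply, Matrix.mul_apply, E, Matrix.of_apply]
    refine Finset.sum_congr rfl fun i _ => Finset.sum_congr rfl fun j _ => ?_
    rw [← mul_one (Y i j), ← smul_eq_mul, ← Matrix.smul_single, map_smul]
    simp
  -- On Hermitian arguments the Hermitian part of `E` gives the real part of `f`.
  let X : Matrix P P ℂ := (1 / 2 : ℝ) • (E + E.conjTranspose)
  have hXh : X.IsHermitian := by
    simp only [X, Matrix.IsHermitian, Matrix.conjTranspose_smul, Matrix.conjTranspose_add,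
      Matrix.conjTranspose_conjTranspose, star_trivial, add_comm]
  have hX : ∀ Y : Matrix P P ℂ, Y.IsHermitian → (f Y).re = (Y * X).trace.re := by
    intro Y hY
    have h2 : (Y * E.conjTranspose).trace.re = (Y * E).trace.re := by
      have : (Y * E.conjTranspose).trace = star (Y * E).trace := by
        rw [← Matrix.trace_conjTranspose, Matrix.conjTranspose_mul, hY.eq,
          Matrix.trace_mul_comm]
      rw [this]; simp
    rw [hE]
    simp only [X, Matrix.mul_smul, Matrix.trace_smul, Matrix.mul_add, Matrix.trace_add,
      Complex.smul_re, Complex.add_re, h2, smul_eq_mul]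
    ring
  have hvec : ∀ (Z : Matrix P P ℂ) (v : P → ℂ),
      star v ⬝ᵥ Z.mulVec v = (Matrix.vecMulVec v (star v) * Z).trace := by
    intro Z v
    rw [Matrix.trace_mul_comm, Matrix.mul_vecMulVec, Matrix.trace_vecMulVec, dotProduct_comm]
  -- A nonzero `v v*` is a multiple of a state, so `hf` applies after normalization.
  have hbound : ∀ v : P → ℂ, 0 ≤ (Matrix.vecMulVec v (star v) * X).trace.re ∧
      (Matrix.vecMulVec v (star v) * X).trace.re ≤ (Matrix.vecMulVec v (star v)).trace.re := by
    intro v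
    have hps := Matrix.posSemidef_vecMulVec_self_star v
    have htr := Complex.le_def.1 hps.trace_nonneg
    set Y := Matrix.vecMulVec v (star v)
    by_cases hz : Y.trace = 0
    · rw [hps.trace_eq_zero_iff] at hz
      simp [hz]
    have hY : Y.trace = (Y.trace.re : ℂ) := Complex.ext rfl htr.2.symm
    have hpos : 0 < Y.trace.re := htr.1.lt_of_ne fun h => hz (by
      rw [hY, ← h]; simp)
    let σ : State P := ⟨(Y.trace.re)⁻¹ • Y, hps.smul (inv_nonneg.2 hpos.le), by
      rw [Matrix.trace_smul, hY, Complex.ofReal_re, Complex.real_smul, ← Complex.ofReal_mul,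
        inv_mul_cancel₀ hpos.ne', Complex.ofReal_one]⟩
    have h := hf σ
    rw [hX _ σ.posSemidef.1] at h
    simp only [σ, Matrix.smul_mul, Matrix.trace_smul, Complex.smul_re, smul_eq_mul] at h
    obtain ⟨ha, hb⟩ := h
    rw [inv_mul_eq_div] at ha hb
    exact ⟨by simpa using (le_div_iff₀ hpos).1 ha, by simpa using (div_le_iff₀ hpos).1 hb⟩
  have him : ∀ (Z : Matrix P P ℂ), Z.IsHermitian → ∀ v, 0 = (star v ⬝ᵥ Z.mulVec v).im :=
    fun Z hZ v => by
      have h := hZ.im_star_dotProduct_mulVec_self v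
      simpa using h.symm
  refine ⟨X, .of_dotProduct_mulVec_nonneg hXh fun v => ?_,
    .of_dotProduct_mulVec_nonneg (Matrix.isHermitian_one.sub hXh) fun v => ?_,
    fun σ => hX _ σ.posSemidef.1⟩
  · rw [Complex.le_def]
    refine ⟨?_, him X hXh v⟩
    rw [hvec]
    exact (hbound v).1
  · rw [Complex.le_def]
    refine ⟨?_, him _ (Matrix.isHermitian_one.sub hXh) v⟩
    rw [hvec, mul_sub, mul_one, Matrix.trace_sub, Complex.sub_re, Complex.zero_re, sub_nonneg]
    exact (hbound v).2

end Effects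

/-! ### Complete positivity and trace preservation of tensor powers -/

section Channels

variable {A B J : Type*} [Fintype A] [DecidableEq A] [Fintype B] [Fintype J] [DecidableEq J]

/-- The Choi matrix of a completely positive map is a Gram matrix. -/
theorem Channel.exists_gram {P Q : Type*} [Fintype P] [DecidableEq P] [Fintype Q]
    (N : Channel P Q) : ∃ G : (P × Q) → P → Q → ℂ, ∀ x y b b',
      N.map (Matrix.single x y 1) b b' = ∑ k, star (G k x b) * G k y b' := by
  classical
  -- Complete positivity is stated for references `Fin k`, so `e` labels the copy of `P`; `v` is the
  -- unnormalized maximally entangled vector.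
  let e := Fintype.equivFin P
  let v : Fin (Fintype.card P) × P → ℂ := fun z => if e z.2 = z.1 then 1 else 0
  have h := N.completelyPositive _ _ (Matrix.posSemidef_vecMulVec_self_star v)
  have h' := h.submatrix (fun z : P × Q => (e z.1, z.2))
  obtain ⟨G, hG⟩ := h'.exists_eq_conjTranspose_mul_self
  refine ⟨fun k x b => G k (x, b), fun x y b b' => ?_⟩
  have := congrFun (congrFun hG (x, b)) (y, b')
  rw [Matrix.mul_apply] at this
  simp only [Matrix.conjTranspose_apply] at this
  rw [← this]
  simp only [idTensor, LinearMap.coe_mk, AddHom.coe_mk, Matrix.submatrix_apply, Matrix.of_apply]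
  refine congrFun (congrFun (congrArg N.map ?_) b) b'
  ext i j
  simp only [Matrix.submatrix_apply, Matrix.vecMulVec_apply, v, Pi.star_apply,
    Matrix.single_apply, EmbeddingLike.apply_eq_iff_eq]
  by_cases h1 : x = i <;> by_cases h2 : y = j <;> simp [h1, h2, eq_comm]

/-- The tensor power of a completely positive map is completely positive. -/
theorem Channel.tensorPower_completelyPositive (N : Channel (A × J) B) (ℓ : ℕ) {R : Type*}
    [Fintype R] [DecidableEq R]
    {X : Matrix (R × ((Fin ℓ → A) × (Fin ℓ → J))) (R × ((Fin ℓ → A) × (Fin ℓ → J))) ℂ}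
    (hX : X.PosSemidef) : (idTensor R (tensorPower N.map ℓ) X).PosSemidef := by
  classical
  obtain ⟨G, hG⟩ := N.exists_gram
  -- Tensor products of the Kraus operators read off from `G`, extended by the identity on `R`.
  let K : (Fin ℓ → (A × J) × B) →
      Matrix (R × (Fin ℓ → B)) (R × ((Fin ℓ → A) × (Fin ℓ → J))) ℂ :=
    fun k => Matrix.of fun z w => if z.1 = w.1 then
      ∏ i, star (G (k i) (w.2.1 i, w.2.2 i) (z.2 i)) else 0
  have key : idTensor R (tensorPower N.map ℓ) X = ∑ k, K k * X * (K k).conjTranspose := by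
    ext ⟨r, b⟩ ⟨s, b'⟩
    simp only [idTensor, tensorPower, LinearMap.coe_mk, AddHom.coe_mk, Matrix.of_apply,
      Matrix.submatrix_apply, hG, Finset.prod_univ_sum, Fintype.piFinset_univ,
      Finset.prod_mul_distrib, Matrix.sum_apply, Matrix.mul_apply, Matrix.conjTranspose_apply,
      K, Finset.mul_sum, Finset.sum_mul, Fintype.sum_prod_type (α₁ := R), ite_mul, mul_ite, zero_mul,
      mul_zero, apply_ite star, star_zero, Finset.sum_ite_irrel, Finset.sum_const_zero,
      Finset.sum_ite_eq, Finset.mem_univ, if_true, star_prod, star_star]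
    rw [Finset.sum_comm, Finset.sum_comm (γ := Fin ℓ → (A × J) × B)]
    refine Finset.sum_congr rfl fun y _ => ?_
    rw [Finset.sum_comm]
    exact Finset.sum_congr rfl fun k _ => Finset.sum_congr rfl fun x _ => by ring
  rw [key]
  exact Matrix.posSemidef_sum _ fun k _ => hX.mul_mul_conjTranspose_same _

/-- On matrix units the trace factors over the `ℓ` positions, and each factor is a Kronecker delta.
-/
theorem Channel.trace_tensorPower (N : Channel (A × J) B) (ℓ : ℕ)
    (X : Matrix ((Fin ℓ → A) × (Fin ℓ → J)) ((Fin ℓ → A) × (Fin ℓ → J)) ℂ) :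
    (tensorPower N.map ℓ X).trace = X.trace := by
  have h1 : ∀ x y : (Fin ℓ → A) × (Fin ℓ → J), ∑ b : Fin ℓ → B, ∏ i,
      N.map (Matrix.single (x.1 i, x.2 i) (y.1 i, y.2 i) 1) (b i) (b i) =
      if x = y then 1 else 0 := by
    intro x y
    have : ∑ b : Fin ℓ → B, ∏ i,
      N.map (Matrix.single (x.1 i, x.2 i) (y.1 i, y.2 i) 1) (b i) (b i) =
      ∏ i, (N.map (Matrix.single (x.1 i, x.2 i) (y.1 i, y.2 i) 1)).trace := by
      simp only [Matrix.trace, Finset.prod_univ_sum, Fintype.piFinset_univ, Matrix.diag_apply]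
    rw [this]
    simp only [N.tracePreserving]
    split_ifs with h
    · subst h
      simp
    · obtain ⟨i, hi⟩ : ∃ i, (x.1 i, x.2 i) ≠ (y.1 i, y.2 i) := by
        by_contra! hc
        exact h (Prod.ext (funext fun i => congrArg Prod.fst (hc i))
          (funext fun i => congrArg Prod.snd (hc i)))
      exact Finset.prod_eq_zero (Finset.mem_univ i) (Matrix.trace_single_eq_of_ne _ _ _ hi)
  simp only [Matrix.trace, Matrix.diag_apply, tensorPower, LinearMap.coe_mk, AddHom.coe_mk,
    Matrix.of_apply]
  rw [Finset.sum_comm]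
  refine Finset.sum_congr rfl fun x _ => ?_
  rw [Finset.sum_comm]
  simp only [← Finset.mul_sum, h1]
  simp

theorem trace_idTensor {R P Q : Type*} [Fintype R] [Fintype P] [Fintype Q]
    {T : Matrix P P ℂ →ₗ[ℂ] Matrix Q Q ℂ} (hT : ∀ X, (T X).trace = X.trace)
    (X : Matrix (R × P) (R × P) ℂ) : (idTensor R T X).trace = X.trace := by
  simp only [Matrix.trace, Fintype.sum_prod_type, Matrix.diag_apply, idTensor, LinearMap.coe_mk,
    AddHom.coe_mk, Matrix.of_apply]
  refine Finset.sum_congr rfl fun r _ => ?_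
  exact hT (X.submatrix (Prod.mk r) (Prod.mk r))

end Channels

/-! ### Errors of deterministic codes as effects -/

section Codes

variable {A B J : Type*} [Fintype A] [DecidableEq A] [Fintype B] [Fintype J] [DecidableEq J]

/-- The output state of `ℓ` uses of the channel. -/
noncomputable def outputState (N : Channel (A × J) B) {ℓ : ℕ} (ρ : State (Fin ℓ → A)) (σ : State (Fin ℓ → J)) :
    State (Fin ℓ → B) where
  mat := tensorPower N.map ℓ (ρ.mat ⊗ₖ σ.mat)
  posSemidef := (N.tensorPower_completelyPositive ℓ (R := Unit)
    ((ρ.posSemidef.kronecker σ.posSemidef).submatrix Prod.snd)).submatrix (Prod.mk ())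
  trace_eq_one := by
    rw [N.trace_tensorPower, Matrix.trace_kronecker, ρ.trace_eq_one, σ.trace_eq_one, one_mul]

/-- The error probability of a classical code is the expectation of a matrix `0 ≤ X ≤ 1` in the
jammer state. -/
theorem exists_effect_errorProb [DecidableEq B] (N : Channel (A × J) B)
    {ℓ M : ℕ} (C : ClassicalCode A B ℓ M) :
    ∃ X : Matrix (Fin ℓ → J) (Fin ℓ → J) ℂ, X.PosSemidef ∧ (1 - X).PosSemidef ∧
      ∀ σ : State (Fin ℓ → J), errorProb N C σ = (σ.mat * X).trace.re := by
  let f : Matrix (Fin ℓ → J) (Fin ℓ → J) ℂ →ₗ[ℂ] ℂ :=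
    { toFun := fun σ => (1 / M : ℝ) * ∑ m, (tensorPower N.map ℓ ((C.encoder m).mat ⊗ₖ σ) *
        (1 - C.decoder m)).trace
      map_add' := fun σ τ => by
        simp only [Matrix.kronecker_add, map_add, Matrix.add_mul, Matrix.trace_add,
          Finset.sum_add_distrib, mul_add]
      map_smul' := fun c σ => by
        simp only [Matrix.kronecker_smul, map_smul, Matrix.smul_mul, Matrix.trace_smul,
          ← Finset.mul_sum, smul_eq_mul, RingHom.id_apply]
        ring }
  have hf : ∀ σ : State (Fin ℓ → J), (f σ.mat).re = errorProb N C σ := fun σ => by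
    simp only [f, LinearMap.coe_mk, AddHom.coe_mk, errorProb, Complex.re_ofReal_mul,
      Complex.re_sum]
  have hD : ∀ m, (1 - C.decoder m).PosSemidef := fun m => by
    rw [← C.decoder_sum, ← Finset.sum_erase_eq_sub (Finset.mem_univ m)]
    exact Matrix.posSemidef_sum _ fun k _ => C.decoder_posSemidef k
  obtain ⟨X, h0, h1, hX⟩ := exists_effect f fun σ => by
    have hm : ∀ m, ((outputState N (C.encoder m) σ).mat * (1 - C.decoder m)).trace.re ∈
        Set.Icc (0 : ℝ) 1 := fun m =>
      State.trace_mul_re_mem_Icc _ (hD m) (by simpa using C.decoder_posSemidef m)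
    rw [hf]
    refine ⟨mul_nonneg (by positivity) (Finset.sum_nonneg fun m _ => (hm m).1), ?_⟩
    have hs : ∑ m, ((outputState N (C.encoder m) σ).mat * (1 - C.decoder m)).trace.re ≤ M := by
      simpa using Finset.sum_le_sum fun m (_ : m ∈ Finset.univ) => (hm m).2
    calc errorProb N C σ ≤ (1 / M : ℝ) * M := mul_le_mul_of_nonneg_left hs (by positivity)
      -- An inequality, because `M = 0` gives `1 / M * M = 0`.
      _ ≤ 1 := by rw [one_div_mul_eq_div]; exact div_self_le_one _
  exact ⟨X, h0, h1, fun σ => (hf σ).symm.trans (hX σ)⟩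

/-- Tensoring with a state preserves positivity; the reindexing only regroups the factors. -/
theorem fixSecond_completelyPositive {P Q R S : Type*} [Fintype P] [Fintype Q] [Fintype R]
    {T : Matrix (P × S) (P × S) ℂ →ₗ[ℂ] Matrix Q Q ℂ} [Fintype S]
    (hT : ∀ X : Matrix (R × (P × S)) (R × (P × S)) ℂ, X.PosSemidef →
      (idTensor R T X).PosSemidef) (σ : State S) {X : Matrix (R × P) (R × P) ℂ}
    (hX : X.PosSemidef) : (idTensor R (fixSecond T σ.mat) X).PosSemidef :=
  hT _ ((hX.kronecker σ.posSemidef).submatrix fun z : R × (P × S) => ((z.1, z.2.1), z.2.2))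

/-- The unnormalized vector `∑ i, |ii⟩`. -/
def diagonalVec (L : ℕ) : Fin L × Fin L → ℂ := fun z => if z.1 = z.2 then 1 else 0

theorem star_diagonalVec_dotProduct (L : ℕ) : star (diagonalVec L) ⬝ᵥ diagonalVec L = L := by
  simp [diagonalVec, dotProduct, Fintype.sum_prod_type, apply_ite]

theorem maxEntangled_eq_vecMulVec (L : ℕ) :
    maxEntangled L = (1 / L : ℝ) • Matrix.vecMulVec (diagonalVec L) (star (diagonalVec L)) := by
  ext ⟨a, b⟩ ⟨c, d⟩
  simp only [maxEntangled, Matrix.smul_apply, Matrix.sum_apply, Matrix.single_apply, diagonalVec,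
    Matrix.vecMulVec_apply, Pi.star_apply, Prod.mk.injEq, Complex.real_smul, smul_eq_mul]
  push_cast
  congr 1
  by_cases h1 : a = b <;> by_cases h2 : c = d <;> simp [h1, h2, ite_and, Finset.sum_ite_irrel]

/-- The maximally entangled state. -/
noncomputable def maxEntangledState (L : ℕ) [NeZero L] : State (Fin L × Fin L) where
  mat := maxEntangled L
  posSemidef := by
    rw [maxEntangled_eq_vecMulVec]
    exact (Matrix.posSemidef_vecMulVec_self_star _).smul (by positivity)
  trace_eq_one := by
    have : (L : ℂ) ≠ 0 := NeZero.ne _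
    rw [maxEntangled_eq_vecMulVec, Matrix.trace_smul, Matrix.trace_vecMulVec, dotProduct_comm,
      star_diagonalVec_dotProduct, Complex.real_smul]
    push_cast
    field_simp

/-- `maxEntangled L` is a projection, so its complement is its own Gram matrix. -/
theorem posSemidef_one_sub_maxEntangled (L : ℕ) [NeZero L] :
    (1 - maxEntangled L).PosSemidef := by
  have hh : (maxEntangled L).IsHermitian := (maxEntangledState L).posSemidef.1
  have hsq : maxEntangled L * maxEntangled L = maxEntangled L := by
    have : (L : ℂ) ≠ 0 := NeZero.ne _
    rw [maxEntangled_eq_vecMulVec, Matrix.smul_mul, Matrix.mul_smul,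
      Matrix.vecMulVec_mul_vecMulVec, star_diagonalVec_dotProduct]
    ext x y
    simp [Matrix.vecMulVec_apply, this]
  have := Matrix.posSemidef_conjTranspose_mul_self (1 - maxEntangled L)
  rwa [(Matrix.isHermitian_one.sub hh).eq, sub_mul, mul_sub, mul_sub, hsq, one_mul, one_mul,
    mul_one, sub_self, sub_zero] at this

/-- The infidelity of a quantum code is the expectation of a matrix `0 ≤ X ≤ 1` in the jammer
state. -/
theorem exists_effect_infidelity (N : Channel (A × J) B) {ℓ L : ℕ} (Q : QuantumCode A B ℓ L) :
    ∃ X : Matrix (Fin ℓ → J) (Fin ℓ → J) ℂ, X.PosSemidef ∧ (1 - X).PosSemidef ∧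
      ∀ σ : State (Fin ℓ → J), infidelity N Q σ = (σ.mat * X).trace.re := by
  let T : Matrix (Fin ℓ → J) (Fin ℓ → J) ℂ → Matrix (Fin L × Fin L) (Fin L × Fin L) ℂ :=
    fun σ => idTensor (Fin L)
      (Q.decoder.map ∘ₗ fixSecond (tensorPower N.map ℓ) σ ∘ₗ Q.encoder.map) (maxEntangled L)
  have hadd : ∀ σ τ, T (σ + τ) = T σ + T τ := fun σ τ => by
    ext x y
    simp [T, idTensor, fixSecond, Matrix.kronecker_add]
  have hsmul : ∀ (c : ℂ) σ, T (c • σ) = c • T σ := fun c σ => by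
    ext x y
    simp [T, idTensor, fixSecond, Matrix.kronecker_smul]
  let f : Matrix (Fin ℓ → J) (Fin ℓ → J) ℂ →ₗ[ℂ] ℂ :=
    -- The constant 1 becomes `tr σ`, which makes the infidelity linear.
    { toFun := fun σ => σ.trace - (T σ * maxEntangled L).trace
      map_add' := fun σ τ => by
        simp only [hadd, Matrix.add_mul, Matrix.trace_add]
        ring
      map_smul' := fun c σ => by
        simp only [hsmul, Matrix.smul_mul, Matrix.trace_smul, smul_eq_mul, RingHom.id_apply]
        ring }
  have hf : ∀ σ : State (Fin ℓ → J), (f σ.mat).re = infidelity N Q σ := fun σ => by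
    simp only [f, LinearMap.coe_mk, AddHom.coe_mk, infidelity, σ.trace_eq_one, Complex.sub_re,
      Complex.one_re, T]
  obtain ⟨X, h0, h1, hX⟩ := exists_effect f fun σ => by
    rw [hf]
    -- For `L = 0` there is no entangled state, and the infidelity is 1.
    rcases Nat.eq_zero_or_pos L with rfl | hL
    · simp [infidelity, Matrix.trace]
    have : NeZero L := ⟨hL.ne'⟩
    let ω : State (Fin L × Fin L) :=
      { mat := T σ.mat
        posSemidef := Q.decoder.completelyPositive L _ (fixSecond_completelyPositive
          (fun _ h => N.tensorPower_completelyPositive ℓ h) σ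
          (Q.encoder.completelyPositive L _ (maxEntangledState L).posSemidef))
        trace_eq_one := by
          rw [← (maxEntangledState L).trace_eq_one]
          refine trace_idTensor (fun Y => ?_) _
          rw [LinearMap.comp_apply, Q.decoder.tracePreserving, LinearMap.comp_apply]
          refine (N.trace_tensorPower ℓ _).trans ?_
          rw [Matrix.trace_kronecker, σ.trace_eq_one, mul_one, Q.encoder.tracePreserving] }
    have h := ω.trace_mul_re_mem_Icc (maxEntangledState L).posSemidef
      (posSemidef_one_sub_maxEntangled L)
    exact ⟨sub_nonneg.2 h.2, sub_le_self _ h.1⟩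
  exact ⟨X, h0, h1, fun σ => (hf σ).symm.trans (hX σ)⟩

end Codes

/-! ### Selecting the codes and counting random bits -/

section Selection

/-- A random code whose deterministic codes have errors that are expectations of matrices
`0 ≤ X ≤ 1` in the jammer state is approximated, up to `δ`, by the uniform distribution on any
`n ≥ (log d) / (2 δ ^ 2)` suitable codes. -/
theorem RandomCode.exists_select_hasError {P Code Λ : Type*} [Fintype P] [DecidableEq P]
    [MeasurableSpace Λ] {err : Code → State P → ℝ}
    (hX : ∀ c, ∃ X : Matrix P P ℂ, X.PosSemidef ∧ (1 - X).PosSemidef ∧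
      ∀ σ : State P, err c σ = (σ.mat * X).trace.re)
    (C : RandomCode err Λ) {ε δ : ℝ} (hδ : 0 < δ) (hC : C.HasError ε) (n : ℕ) [NeZero n]
    (hn : Real.log (Fintype.card P) ≤ 2 * δ ^ 2 * n) :
    ∃ lam : Fin n → Λ, (C.select lam).HasError (ε + δ) := by
  have := C.isProbabilityMeasure
  -- Without states the error bound is vacuous, but indices in `Λ` must still be supplied.
  rcases isEmpty_or_nonempty P with hP | hP
  · obtain ⟨x⟩ := MeasureTheory.nonempty_of_isProbabilityMeasure C.law
    refine ⟨fun _ => x, fun σ => ?_⟩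
    have h := σ.trace_eq_one
    simp [Matrix.trace] at h
  choose X h0 h1 hXerr using hX
  have hε : ∀ σ : State P, ∃ x, (σ.mat * X (C.code x)).trace.re ≤ ε := by
    intro σ
    have hint : MeasureTheory.Integrable (fun x => err (C.code x) σ) C.law := by
      refine MeasureTheory.Integrable.of_mem_Icc 0 1 (C.aemeasurable_err σ)
        (Filter.Eventually.of_forall fun x => ?_)
      rw [hXerr]
      exact σ.trace_mul_re_mem_Icc (h0 _) (h1 _)
    obtain ⟨x, hx⟩ := MeasureTheory.exists_le_integral hint
    refine ⟨x, ?_⟩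
    rw [← hXerr]
    exact hx.trans (hC σ)
  -- `t = 4 δ` minimizes `(log d) / t + n t / 8` when `n = (log d) / (2 δ²)`.
  obtain ⟨lam, hlam⟩ := exists_sum_trace_mul_le (fun x => X (C.code x)) (fun x => h0 _)
    (fun x => h1 _) hε (t := 4 * δ) (by positivity) n
  refine ⟨lam, fun σ => ?_⟩
  have hn0 : (0 : ℝ) < n := Nat.cast_pos.2 (NeZero.pos n)
  have hI : ∫ ν, err ((C.select lam).code ν) σ ∂(C.select lam).law =
      (n : ℝ)⁻¹ * ∑ ν, (σ.mat * X (C.code (lam ν))).trace.re := by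
    simp only [RandomCode.select]
    rw [PMF.integral_eq_sum, Finset.mul_sum]
    refine Finset.sum_congr rfl fun ν _ => ?_
    simp [hXerr]
  rw [hI, inv_mul_le_iff₀ hn0]
  have h := hlam σ
  have h4 : 4 * δ * ∑ ν, (σ.mat * X (C.code (lam ν))).trace.re ≤ 4 * δ * (n * (ε + δ)) := by
    nlinarith
  exact le_of_mul_le_mul_left h4 (by positivity)

/-- For `ℓ ≥ 2`, `1 + c ℓ ≤ (1 + c) ℓ`, and `log ℓ ≥ log 2` absorbs the constant `log (1 + c)`. -/
theorem isBigO_logb_one_add_mul {c : ℝ} (hc : 0 ≤ c) :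
    (fun ℓ : ℕ => Real.logb 2 (1 + c * ℓ)) =O[Filter.atTop] (fun ℓ : ℕ => Real.log ℓ) := by
  refine Asymptotics.IsBigO.of_bound ((Real.log (1 + c) / Real.log 2 + 1) / Real.log 2) ?_
  filter_upwards [Filter.eventually_ge_atTop 2] with ℓ hℓ
  have h2 : (2 : ℝ) ≤ ℓ := by exact_mod_cast hℓ
  have hl2 : 0 < Real.log 2 := Real.log_pos one_lt_two
  have hl : Real.log 2 ≤ Real.log ℓ := Real.log_le_log two_pos h2
  have hc1 : 0 ≤ Real.log (1 + c) := Real.log_nonneg (by linarith)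
  have h1 : 1 ≤ 1 + c * ℓ := le_add_of_nonneg_right (by positivity)
  have hle : Real.log (1 + c * ℓ) ≤ Real.log (1 + c) + Real.log ℓ := by
    rw [← Real.log_mul (by positivity) (by positivity)]
    exact Real.log_le_log (by positivity) (by nlinarith)
  rw [Real.norm_of_nonneg (Real.logb_nonneg one_lt_two h1),
    Real.norm_of_nonneg (hl2.le.trans hl), Real.logb, div_mul_eq_mul_div]
  refine div_le_div_of_nonneg_right (hle.trans ?_) hl2.le
  rw [add_mul, one_mul]
  gcongr
  rw [div_mul_eq_mul_div, le_div_iff₀ hl2]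
  gcongr

end Selection

end QAVC

theorem proposition4 {J : Type*} [Fintype J] [DecidableEq J] (δ : ℝ) (hδ : 0 < δ) :
    -- `bits ℓ` bounds the number of shared random bits; it depends on `J`, `δ`, `ℓ` only
    ∃ bits : ℕ → ℝ, bits =O[Filter.atTop] (fun ℓ : ℕ => Real.log ℓ) ∧
      ∀ {A : Type*} {B : Type*} [Fintype A] [DecidableEq A] [Fintype B] [DecidableEq B]
        (N : QAVC.Channel (A × J) B) (ℓ : ℕ) {Λ : Type*} [MeasurableSpace Λ] (ε : ℝ),
        (∀ (M : ℕ) (C : QAVC.RandomClassicalCode N ℓ M Λ), C.HasError ε →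
          ∃ (n : ℕ) (_ : NeZero n) (lam : Fin n → Λ),
            (n : ℝ) ≤ 1 + 1 / (2 * δ ^ 2) * Real.log (Fintype.card J) * ℓ ∧
            Real.logb 2 n ≤ bits ℓ ∧
            (C.select lam).HasError (ε + δ)) ∧
        (∀ (L : ℕ) (C : QAVC.RandomQuantumCode N ℓ L Λ), C.HasError ε →
          ∃ (n : ℕ) (_ : NeZero n) (lam : Fin n → Λ),
            (n : ℝ) ≤ 1 + 1 / (2 * δ ^ 2) * Real.log (Fintype.card J) * ℓ ∧
            Real.logb 2 n ≤ bits ℓ ∧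
            (C.select lam).HasError (ε + δ)) := by
  set c : ℝ := 1 / (2 * δ ^ 2) * Real.log (Fintype.card J) with hc
  have hc0 : 0 ≤ c := mul_nonneg (by positivity) (Real.log_natCast_nonneg _)
  refine ⟨fun ℓ => Real.logb 2 (1 + c * ℓ), QAVC.isBigO_logb_one_add_mul hc0, ?_⟩
  intro A B _ _ _ _ N ℓ Λ _ ε
  have hcℓ : 0 ≤ c * ℓ := by positivity
  -- `n = ⌊c ℓ⌋ + 1` is positive even if `c ℓ = 0`, and satisfies `c ℓ ≤ n ≤ 1 + c ℓ`.
  have hn : ((⌊c * ℓ⌋₊ + 1 : ℕ) : ℝ) ≤ 1 + c * ℓ := by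
    have := Nat.floor_le hcℓ
    push_cast
    linarith
  have hbits : Real.logb 2 ((⌊c * ℓ⌋₊ + 1 : ℕ) : ℝ) ≤ Real.logb 2 (1 + c * ℓ) :=
    Real.logb_le_logb_of_le one_lt_two (by positivity) hn
  have hlog : Real.log (Fintype.card (Fin ℓ → J)) ≤
      2 * δ ^ 2 * ((⌊c * ℓ⌋₊ + 1 : ℕ) : ℝ) := by
    have h1 : Real.log (Fintype.card (Fin ℓ → J)) = 2 * δ ^ 2 * (c * ℓ) := by
      rw [Fintype.card_fun, Fintype.card_fin, Nat.cast_pow, Real.log_pow, hc]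
      field_simp
    have h2 := (Nat.lt_floor_add_one (c * ℓ)).le
    rw [h1]
    push_cast
    gcongr
  refine ⟨fun M C hC => ?_, fun L C hC => ?_⟩
  · obtain ⟨lam, h⟩ := C.exists_select_hasError (QAVC.exists_effect_errorProb N) hδ hC _ hlog
    exact ⟨_, inferInstance, lam, hn, hbits, h⟩
  · obtain ⟨lam, h⟩ := C.exists_select_hasError (QAVC.exists_effect_infidelity N) hδ hC _ hlog
    exact ⟨_, inferInstance, lam, hn, hbits, h⟩
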